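/- **Setting.** Linear integer arithmetic (LIA) formulas are built from atoms $t_1\le t_2$ and $c\mid t$ ($t_i,t$ integer linear terms, $c\in\mathbb Z$) with $\land,\lor,\lnot,\exists,\forall$, interpreted over $\mathbb Z$. A transition formula $F(\vec x,\vec x')$ is an LIA formula in variables $x_1,\dots,x_n$ and primed copies; it defines the relation $v\to_F v'$ on $\mathbb Q^n$ that holds iff $v,v'$ are integral and $F(v,v')$ is true. A transition system is a relation $R\subseteq S\times S$ on a finite-dimensional $\mathbb Q$-vector space $S$; it is linear (affine) if $R$ is a linear (a possibly empty affine) subspace of $S\times S$, and deterministic if every state has at most one successor. $\mathrm{dom}^\omega(R)$ is the set of states $x_0$ that start an infinite computation $x_0\to x_1\to x_2\to\cdots$. A simulation is a linear map $s$ such that $x\to x'$ implies $s(x)\to s(x')$. The homogenization of $R$ is the linear system on $S\times\mathbb Q$ spanned by the transitions $(x,1)\to(x',1)$ with $x\to x'$ in $R$. For a deterministic linear system $T$, $T|_\omega$ is the linear map that $T$ induces on the subspace $\mathrm{dom}^\omega(T)$, and $\mathbb Z(T)$ is the span of the generalized eigenvectors of $T|_\omega$ with integer eigenvalues; $T|_{\mathbb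 Z(T)}$ is the linear map that $T$ induces on $\mathbb Z(T)$. A $\mathbb Q$-DATS is a deterministic affine system whose homogenization $T$ is deterministic and such that all complex roots of the characteristic polynomial of $T|_\omega$ are rational. A $\mathbb Q$-DATS-reflection of a system $D$ is a $\mathbb Q$-DATS $V$ with a simulation $q:D\to V$ through which every simulation from $D$ to a $\mathbb Q$-DATS factors by a unique simulation. **The procedure $\mathrm{mp}$.** On input $F$: 1. Let $A$ be the affine hull of $\to_F$. Let $\Lambda\subseteq(\mathbb Q^n)^\star$ be the greatest fixpoint of the operator that maps a space $\Lambda$ of functionals to the space of those $f$ for which $x_1\to_A x_1'$, $x_2\to_A x_2'$ and $g(x_1)=g(x_2)$ for all $g\in\Lambda$ imply $f(x_1')=f(x_2')$. Let $d:\mathbb Q^n\to\Lambda^\star$, $d(x)(f)=f(x)$, and let $D$ be the image of $A$ under $d$. 2. Choose a $\mathbb Q$-DATS-reflection $(V,q)$ of $D$. Let $T$ be the homogenization of $V$ and $t(x)=(q(d(x)),1)$. 3. Choose a linear projection $p$ of the state space of $T$ onto $\mathbb Z(T)$ and a matrix $C$ with kernel $\mathbb Z(T)$, in coordinates on the state space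 of $T$ and on $\mathbb Z(T)$ in which $t$, $p$, $C$ have integer entries. Let $M$ be the matrix of $T|_{\mathbb Z(T)}$. 4. Let $G(\vec w)$ be the formula $\exists\vec x,\vec x'.\ F(\vec x,\vec x')\land\vec w=p(t(\vec x))\land C\,t(\vec x)=0$. 5. Choose a quantifier-free LIA formula $G'$ equivalent to $G$ and compute a periodic characteristic sequence $(H_0,\dots,H_P)^\omega=\chi(G',M)$, where $\chi$ commutes pointwise with $\land,\lor,\lnot$ and is defined on atoms as follows. A closed form of a sequence of row vectors $u_k$ is an expression $\frac1Q\sum_i\lambda_i^k k^{d_i}a_i^{\mathsf T}\vec w$, with $Q\ge1$, $\lambda_i\in\mathbb Z$, $d_i\in\mathbb N$, $a_i$ integral, that equals $u_k\vec w$ for all but finitely many $k$. - For $c^{\mathsf T}\vec w+e\ge0$: take closed forms $\frac1{Q_0}p_0$ of $c^{\mathsf T}M^{2k}$ and $\frac1{Q_1}p_1$ of $c^{\mathsf T}M^{2k+1}$ with all $\lambda_i>0$ and summands in strictly decreasing order of growth; then $\chi=(\mathrm{DTA}(p_0+eQ_0),\mathrm{DTA}(p_1+eQ_1))^\omega$,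 where $\mathrm{DTA}(0)=\mathit{true}$ and $\mathrm{DTA}(\lambda^kk^d\ell(\vec w)+p)=(\ell(\vec w)\ge1)\lor(\ell(\vec w)=0\land\mathrm{DTA}(p))$. - For $m\mid c^{\mathsf T}\vec w+e$: take a closed form of $c^{\mathsf T}M^k$ and periodic integer sequences $z_{i,k}$ with $z_{i,k}\equiv\lambda_i^kk^{d_i}\pmod{Qm}$ for all but finitely many $k$; then the $k$-th term of $\chi$ is $Qm\mid\sum_iz_{i,k}a_i^{\mathsf T}\vec w+Qe$. 6. Return $\lnot\big(\bigwedge_{i=0}^{P}H_i(p(t(\vec x)))\land C\,t(\vec x)=0\big)$. The set $\mathrm{mp}(F)\subseteq\mathbb Q^n$ consists of the integral states that satisfy this formula together with all non-integral states. **Theorem (Soundness).** For every transition formula $F$, every set $\mathrm{mp}(F)$ computed by this procedure (whatever choices are made in it), and every state $s\in\mathrm{mp}(F)$, we have $s\notin\mathrm{dom}^\omega(F)$; that is, no infinite $F$-computation starts from $s$. -/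

import Mathlib

noncomputable section

namespace MortalPrecondition

/-! ### Linear integer arithmetic -/

/-- Terms of linear integer arithmetic (LIA) over the variables `x_0, …, x_{n-1}`. -/
inductive Term (n : ℕ) : Type
  | var (i : Fin n) : Term n
  | const (c : ℤ) : Term n
  | smul (c : ℤ) (t : Term n) : Term n
  | add (t s : Term n) : Term n

namespace Term

def eval {n : ℕ} (v : Fin n → ℤ) : Term n → ℤ
  | var i => v i
  | const c => c
  | smul c t => c * t.eval v
  | add t s => t.eval v + s.eval v

/-- Simultaneous substitution of terms for variables. -/
def subst {n m : ℕ} (σ : Fin n → Term m) : Term n → Term m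
  | var i => σ i
  | const c => const c
  | smul c t => smul c (t.subst σ)
  | add t s => add (t.subst σ) (s.subst σ)

/-- The coefficient of `x_i`, when a term is written as `cᵀx + d`. -/
def coeff {n : ℕ} : Term n → Fin n → ℤ
  | var i => Pi.single i 1
  | const _ => 0
  | smul c t => c • t.coeff
  | add t s => t.coeff + s.coeff

/-- The constant `d`, when a term is written as `cᵀx + d`. -/
def constPart {n : ℕ} : Term n → ℤ
  | var _ => 0
  | const c => c
  | smul c t => c * t.constPart
  | add t s => t.constPart + s.constPart

/-- The term `aᵀx + c`. -/
def affine {n : ℕ} (a : Fin n → ℤ) (c : ℤ) : Term n :=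
  (List.ofFn fun i => smul (a i) (var i)).foldr add (const c)

end Term

/-- LIA formulas whose free variables are among `x_0, …, x_{n-1}`. A quantifier binds the last
variable of its body. -/
inductive Formula : ℕ → Type
  | le {n : ℕ} (t s : Term n) : Formula n
  | dvd {n : ℕ} (c : ℤ) (t : Term n) : Formula n
  | and {n : ℕ} (φ ψ : Formula n) : Formula n
  | or {n : ℕ} (φ ψ : Formula n) : Formula n
  | not {n : ℕ} (φ : Formula n) : Formula n
  | ex {n : ℕ} (φ : Formula (n + 1)) : Formula n
  | all {n : ℕ} (φ : Formula (n + 1)) : Formula n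

namespace Formula

/-- Satisfaction in the standard model of the integers. -/
def Sat : {n : ℕ} → Formula n → (Fin n → ℤ) → Prop
  | _, le t s, v => t.eval v ≤ s.eval v
  | _, dvd c t, v => c ∣ t.eval v
  | _, and φ ψ, v => φ.Sat v ∧ ψ.Sat v
  | _, or φ ψ, v => φ.Sat v ∨ ψ.Sat v
  | _, not φ, v => ¬ φ.Sat v
  | _, ex φ, v => ∃ z : ℤ, φ.Sat (Fin.snoc (α := fun _ => ℤ) v z)
  | _, all φ, v => ∀ z : ℤ, φ.Sat (Fin.snoc (α := fun _ => ℤ) v z)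

/-- Renaming of free variables. -/
def rename : {n m : ℕ} → (Fin n → Fin m) → Formula n → Formula m
  | _, _, f, le t s => le (t.subst fun i => .var (f i)) (s.subst fun i => .var (f i))
  | _, _, f, dvd c t => dvd c (t.subst fun i => .var (f i))
  | _, _, f, and φ ψ => and (φ.rename f) (ψ.rename f)
  | _, _, f, or φ ψ => or (φ.rename f) (ψ.rename f)
  | _, _, f, not φ => not (φ.rename f)
  | _, m, f, ex φ =>
      ex (φ.rename (Fin.snoc (α := fun _ => Fin (m + 1)) (fun i => (f i).castSucc) (Fin.last m)))
  | _, m, f, all φ =>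
      all (φ.rename (Fin.snoc (α := fun _ => Fin (m + 1)) (fun i => (f i).castSucc) (Fin.last m)))

/-- Existential quantification over the last `k` variables. -/
def exs {m : ℕ} : (k : ℕ) → Formula (m + k) → Formula m
  | 0, φ => φ
  | k + 1, φ => exs k (ex φ)

/-- The equation `t = s`. -/
def eq {n : ℕ} (t s : Term n) : Formula n := and (le t s) (le s t)

/-- Conjunction of a finite list of formulas; the empty conjunction is `0 ≤ 0`. -/
def conj {n : ℕ} (l : List (Formula n)) : Formula n :=
  l.foldr and (le (.const 0) (.const 0))

end Formula

/-- Quantifier-free LIA formulas. -/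
inductive QF (n : ℕ) : Type
  | le (t s : Term n) : QF n
  | dvd (c : ℤ) (t : Term n) : QF n
  | and (φ ψ : QF n) : QF n
  | or (φ ψ : QF n) : QF n
  | not (φ : QF n) : QF n

namespace QF

def toFormula {n : ℕ} : QF n → Formula n
  | le t s => .le t s
  | dvd c t => .dvd c t
  | and φ ψ => .and φ.toFormula ψ.toFormula
  | or φ ψ => .or φ.toFormula ψ.toFormula
  | not φ => .not φ.toFormula

/-- Simultaneous substitution of terms for variables. -/
def subst {n m : ℕ} (σ : Fin n → Term m) : QF n → QF m
  | le t s => le (t.subst σ) (s.subst σ)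
  | dvd c t => dvd c (t.subst σ)
  | and φ ψ => and (φ.subst σ) (ψ.subst σ)
  | or φ ψ => or (φ.subst σ) (ψ.subst σ)
  | not φ => not (φ.subst σ)

end QF

/-! ### Transition systems

A transition system is a finite-dimensional linear space `S` over `ℚ` with a relation
`R : Set (S × S)`. -/

section TransitionSystems

variable {S U : Type} [AddCommGroup S] [Module ℚ S] [AddCommGroup U] [Module ℚ U]

/-- The `ω`-domain: the states from which there is an infinite computation. -/
def domOmega {S : Type} (R : Set (S × S)) : Set S :=
  {x | ∃ f : ℕ → S, f 0 = x ∧ ∀ k, (f k, f (k + 1)) ∈ R}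

def IsDeterministic {S : Type} (R : Set (S × S)) : Prop :=
  ∀ x y z, (x, y) ∈ R → (x, z) ∈ R → y = z

/-- The relation is an affine subspace (possibly empty). -/
def IsAffine (R : Set (S × S)) : Prop :=
  ∃ A : AffineSubspace ℚ (S × S), R = A

/-- The linear map `s` is a simulation from `(S, R)` to `(U, Q)`. -/
def IsSimulation (R : Set (S × S)) (Q : Set (U × U)) (s : S →ₗ[ℚ] U) : Prop :=
  ∀ x y, (x, y) ∈ R → (s x, s y) ∈ Q

/-- A transition formula in the variables `x_0, …, x_{n-1}` and their primed copies is a formula in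
`n + n` variables, the first `n` being the unprimed ones. This is the transition relation that it
defines on the state space `ℚⁿ`; only integral states take part in transitions. -/
def tfRel {n : ℕ} (F : Formula (n + n)) : Set ((Fin n → ℚ) × (Fin n → ℚ)) :=
  {x | ∃ u u' : Fin n → ℤ, (x.1 = fun i => (u i : ℚ)) ∧ (x.2 = fun i => (u' i : ℚ)) ∧
    F.Sat (Fin.append u u')}

/-- A class (full subcategory) of transition systems. -/
abbrev TSClass : Type 1 :=
  ∀ (W : Type) [AddCommGroup W] [Module ℚ W] [FiniteDimensional ℚ W], Set (W × W) → Prop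

/-- `((U, Q), s)` is a `C`-reflection of `(S, R)`. -/
def IsReflection (C : TSClass) [FiniteDimensional ℚ U]
    (R : Set (S × S)) (Q : Set (U × U)) (s : S →ₗ[ℚ] U) : Prop :=
  C U Q ∧ IsSimulation R Q s ∧
    ∀ (W : Type) [AddCommGroup W] [Module ℚ W] [FiniteDimensional ℚ W] (Y : Set (W × W)),
      C W Y → ∀ t : S →ₗ[ℚ] W, IsSimulation R Y t →
        ∃! t' : U →ₗ[ℚ] W, IsSimulation Q Y t' ∧ t' ∘ₗ s = t

/-! ### Reflections via the dual space, and determinization -/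

/-- The map `S → Λ⋆` that sends `x` to `f ↦ f x`. -/
def alphaMap (Λ : Submodule ℚ (Module.Dual ℚ S)) : S →ₗ[ℚ] Module.Dual ℚ Λ :=
  Λ.subtype.dualMap ∘ₗ Module.Dual.eval ℚ S

/-- The transition relation of `α_Λ(S, R)`, the image of `R` under `alphaMap Λ`. -/
def alphaRel (Λ : Submodule ℚ (Module.Dual ℚ S)) (R : Set (S × S)) :
    Set (Module.Dual ℚ Λ × Module.Dual ℚ Λ) :=
  {y | ∃ x x' : S, (x, x') ∈ R ∧ y = (alphaMap Λ x, alphaMap Λ x')}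

/-- `Det(R, Λ)`, the functionals `f` such that `R` is `(Λ, {f})`-deterministic. -/
def detStep (R : Set (S × S)) (Λ : Submodule ℚ (Module.Dual ℚ S)) :
    Submodule ℚ (Module.Dual ℚ S) where
  carrier := {f | ∀ x₁ x₂ x₁' x₂' : S, (∀ g ∈ Λ, g x₁ = g x₂) →
    (x₁, x₁') ∈ R → (x₂, x₂') ∈ R → f x₁' = f x₂'}
  add_mem' := by
    intro f g hf hg x₁ x₂ x₁' x₂' h h₁ h₂
    simp [hf x₁ x₂ x₁' x₂' h h₁ h₂, hg x₁ x₂ x₁' x₂' h h₁ h₂]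
  zero_mem' := by
    intro x₁ x₂ x₁' x₂' h h₁ h₂
    simp
  smul_mem' := by
    intro c f hf x₁ x₂ x₁' x₂' h h₁ h₂
    simp [hf x₁ x₂ x₁' x₂' h h₁ h₂]

/-- The monotone operator `Det(R, -)`. -/
def detOp (R : Set (S × S)) :
    Submodule ℚ (Module.Dual ℚ S) →o Submodule ℚ (Module.Dual ℚ S) where
  toFun := detStep R
  monotone' := by
    intro Λ₁ Λ₂ h f hf x₁ x₂ x₁' x₂' h' h₁ h₂
    exact hf x₁ x₂ x₁' x₂' (fun g hg => h' g (h hg)) h₁ h₂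

/-- `Det(R)`, the greatest fixpoint of `Det(R, -)`. -/
def det (R : Set (S × S)) : Submodule ℚ (Module.Dual ℚ S) :=
  OrderHom.gfp (detOp R)

/-! ### Deterministic linear transition systems -/

/-- The `ω`-domain of a linear transition system, as a subspace. -/
def omegaSpace (L : Submodule ℚ (S × S)) : Submodule ℚ S where
  carrier := domOmega (L : Set (S × S))
  add_mem' := by
    rintro x y ⟨f, rfl, hf⟩ ⟨g, rfl, hg⟩
    exact ⟨fun k => f k + g k, rfl, fun k => L.add_mem (hf k) (hg k)⟩
  zero_mem' := ⟨fun _ => 0, rfl, fun _ => L.zero_mem⟩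
  smul_mem' := by
    rintro c x ⟨f, rfl, hf⟩
    exact ⟨fun k => c • f k, rfl, fun k => L.smul_mem c (hf k)⟩

theorem exists_succ_omegaSpace (L : Submodule ℚ (S × S)) :
    ∀ x ∈ omegaSpace L, ∃ y ∈ omegaSpace L, (x, y) ∈ L := by
  rintro x ⟨f, rfl, hf⟩
  exact ⟨f 1, ⟨fun k => f (k + 1), rfl, fun k => hf (k + 1)⟩, hf 0⟩

/-- The linear map that a deterministic linear transition system defines on a subspace `W` all of
whose states have a successor in `W`. -/
def inducedMap (L : Submodule ℚ (S × S)) (hL : IsDeterministic (L : Set (S × S)))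
    (W : Submodule ℚ S) (hW : ∀ x ∈ W, ∃ y ∈ W, (x, y) ∈ L) : W →ₗ[ℚ] W where
  toFun x := ⟨(hW x x.2).choose, (hW x x.2).choose_spec.1⟩
  map_add' x y := Subtype.ext <| hL _ _ _ (hW _ (x + y).2).choose_spec.2
    (L.add_mem (hW x x.2).choose_spec.2 (hW y y.2).choose_spec.2)
  map_smul' c x := Subtype.ext <| hL _ _ _ (hW _ (c • x).2).choose_spec.2
    (L.smul_mem c (hW x x.2).choose_spec.2)

theorem inducedMap_mem (L : Submodule ℚ (S × S)) (hL : IsDeterministic (L : Set (S × S)))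
    (W : Submodule ℚ S) (hW : ∀ x ∈ W, ∃ y ∈ W, (x, y) ∈ L) (x : W) :
    ((x : S), (inducedMap L hL W hW x : S)) ∈ L :=
  (hW x x.2).choose_spec.2

/-- `T|_ω`, the restriction of a deterministic linear transition system to its `ω`-domain. -/
def omegaMap (L : Submodule ℚ (S × S)) (hL : IsDeterministic (L : Set (S × S))) :
    omegaSpace L →ₗ[ℚ] omegaSpace L :=
  inducedMap L hL (omegaSpace L) (exists_succ_omegaSpace L)

/-- `ℤ(T)`, spanned by the generalized eigenvectors of `T|_ω` for integer eigenvalues. -/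
def intSpace (L : Submodule ℚ (S × S)) (hL : IsDeterministic (L : Set (S × S))) :
    Submodule ℚ S :=
  Submodule.span ℚ {x | ∃ hx : x ∈ omegaSpace L, ∃ r : ℕ, 0 < r ∧ ∃ l : ℤ,
    ((omegaMap L hL - (l : Module.End ℚ (omegaSpace L))) ^ r) ⟨x, hx⟩ = 0}

theorem exists_succ_intSpace (L : Submodule ℚ (S × S))
    (hL : IsDeterministic (L : Set (S × S))) :
    ∀ x ∈ intSpace L hL, ∃ y ∈ intSpace L hL, (x, y) ∈ L := by
  intro x hx
  induction hx using Submodule.span_induction with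
  | mem x h =>
    obtain ⟨hx, r, hr, l, h⟩ := h
    refine ⟨omegaMap L hL ⟨x, hx⟩, Submodule.subset_span ⟨(omegaMap L hL ⟨x, hx⟩).2, r, hr, l, ?_⟩,
      inducedMap_mem L hL _ _ ⟨x, hx⟩⟩
    have hc : Commute ((omegaMap L hL - (l : Module.End ℚ (omegaSpace L))) ^ r)
        (omegaMap L hL) :=
      ((Commute.refl _).sub_left (Int.cast_commute l _)).pow_left r
    have := LinearMap.congr_fun hc.eq ⟨x, hx⟩
    simp only [Module.End.mul_apply, h, map_zero] at this
    exact this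
  | zero => exact ⟨0, Submodule.zero_mem _, L.zero_mem⟩
  | add x y _ _ hx hy =>
    obtain ⟨x', hx', h₁⟩ := hx
    obtain ⟨y', hy', h₂⟩ := hy
    exact ⟨x' + y', Submodule.add_mem _ hx' hy', L.add_mem h₁ h₂⟩
  | smul c x _ hx =>
    obtain ⟨x', hx', h₁⟩ := hx
    exact ⟨c • x', Submodule.smul_mem _ c hx', L.smul_mem c h₁⟩

/-- `T|_{ℤ(T)}`, the integer-spectrum restriction of `T`. -/
def intMap (L : Submodule ℚ (S × S)) (hL : IsDeterministic (L : Set (S × S))) :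
    intSpace L hL →ₗ[ℚ] intSpace L hL :=
  inducedMap L hL (intSpace L hL) (exists_succ_intSpace L hL)

/-- The spectrum of a linear map: the complex roots of its characteristic polynomial. -/
def spec [FiniteDimensional ℚ S] (f : S →ₗ[ℚ] S) : Set ℂ :=
  {z | Polynomial.aeval z f.charpoly = 0}

/-- Deterministic linear transition systems with rational spectrum. -/
def IsQDLTS [FiniteDimensional ℚ S] (L : Submodule ℚ (S × S)) : Prop :=
  ∃ hL : IsDeterministic (L : Set (S × S)), ∀ z ∈ spec (omegaMap L hL), ∃ r : ℚ, z = (r : ℂ)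

/-- The homogenization of an affine transition system, on the state space `S × ℚ`: the linear
relation generated by the transitions `(x, 1) → (x', 1)` with `(x, x') ∈ R`. See `mem_homog`. -/
def homog (R : Set (S × S)) : Submodule ℚ ((S × ℚ) × (S × ℚ)) :=
  Submodule.span ℚ {z | ∃ x x' : S, (x, x') ∈ R ∧ z = ((x, 1), (x', 1))}

/-- For a nonempty affine relation with an arbitrary transition `(x₀, x₀')`, the homogenization
consists of the pairs `(x, c) → (x', c)` with `(x + (1 - c) x₀, x' + (1 - c) x₀') ∈ R`. -/
theorem mem_homog {R : Set (S × S)} (hR : IsAffine R) {x₀ x₀' : S} (h₀ : (x₀, x₀') ∈ R)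
    (z : (S × ℚ) × (S × ℚ)) :
    z ∈ homog R ↔ ∃ (x x' : S) (c : ℚ), z = ((x, c), (x', c)) ∧
      (x + (1 - c) • x₀, x' + (1 - c) • x₀') ∈ R := by
  obtain ⟨A, rfl⟩ := hR
  have key (a b d : ℚ) (p q r : S × S) (hp : p ∈ A) (hq : q ∈ A) (hr : r ∈ A)
      (h : a + b + d = 1) : a • p + b • q + d • r ∈ A := by
    have h1 := A.smul_vsub_vadd_mem b hq hr hr
    have h2 := A.smul_vsub_vadd_mem a hp hr h1
    have : a • p + b • q + d • r = a • (p -ᵥ r) +ᵥ (b • (q -ᵥ r) +ᵥ r) := by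
      simp only [vsub_eq_sub, vadd_eq_add]
      have : d = 1 - a - b := by linarith
      subst this
      module
    rw [this]; exact h2
  constructor
  · intro hz
    induction hz using Submodule.span_induction with
    | mem z h =>
      obtain ⟨x, x', h, rfl⟩ := h
      exact ⟨x, x', 1, rfl, by simpa using h⟩
    | zero => exact ⟨0, 0, 0, rfl, by simpa using h₀⟩
    | add z w _ _ hz hw =>
      obtain ⟨x, x', c, rfl, h⟩ := hz
      obtain ⟨y, y', d, rfl, h'⟩ := hw
      refine ⟨x + y, x' + y', c + d, rfl, ?_⟩
      have := key 1 1 (-1) _ _ _ h h' h₀ (by norm_num)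
      refine (congrArg (· ∈ A) (Prod.ext ?_ ?_)).mp this <;> simp <;> module
    | smul a z _ hz =>
      obtain ⟨x, x', c, rfl, h⟩ := hz
      refine ⟨a • x, a • x', a * c, rfl, ?_⟩
      have := key a 0 (1 - a) _ _ _ h h h₀ (by ring)
      refine (congrArg (· ∈ A) (Prod.ext ?_ ?_)).mp this <;> simp <;> module
  · rintro ⟨x, x', c, rfl, h⟩
    have h1 : (((x + (1 - c) • x₀, 1), (x' + (1 - c) • x₀', 1)) : (S × ℚ) × (S × ℚ)) ∈
      homog (A : Set (S × S)) := Submodule.subset_span ⟨_, _, h, rfl⟩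
    have h2 : (((x₀, 1), (x₀', 1)) : (S × ℚ) × (S × ℚ)) ∈ homog (A : Set (S × S)) :=
      Submodule.subset_span ⟨_, _, h₀, rfl⟩
    convert Submodule.sub_mem _ h1 (Submodule.smul_mem _ (1 - c) h2) using 1
    ext <;> simp

end TransitionSystems

/-- `ℚ-DATS`: deterministic affine transition systems whose homogenization has rational
spectrum. -/
def IsQDATS : TSClass := fun _ _ _ _ R =>
  IsAffine R ∧ IsDeterministic R ∧ IsQDLTS (homog R)

/-! ### Characteristic sequences -/

/-- A summand `λ^k k^d (aᵀx + c)` of an integer exponential-polynomial term. -/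
structure ExpTerm (q : ℕ) where
  base : ℤ
  deg : ℕ
  coeff : Fin q → ℤ
  const : ℤ

/-- `(1 / Q) p(x, k)` is a closed form of `u(k)ᵀ x`, where `u` is a sequence of row vectors: the two
agree as functions of `x` for all but finitely many `k`. -/
def IsClosedForm {q : ℕ} (u : ℕ → Fin q → ℚ) (Q : ℕ) (p : List (ExpTerm q)) : Prop :=
  0 < Q ∧ (∀ e ∈ p, e.const = 0) ∧ ∃ K : ℕ, ∀ k ≥ K, ∀ i,
    (Q : ℚ) * u k i = (p.map fun e => (e.base : ℚ) ^ k * (k : ℚ) ^ e.deg * (e.coeff i : ℚ)).sum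

/-- All bases are positive and the summands are listed by strictly decreasing growth. -/
def IsDominanceOrdered {q : ℕ} (p : List (ExpTerm q)) : Prop :=
  (∀ e ∈ p, 0 < e.base) ∧
    p.Pairwise fun e f => f.base < e.base ∨ (f.base = e.base ∧ f.deg < e.deg)

/-- Add the constant `D`, i.e. `1^k k^0 D`, to a dominance-ordered exponential-polynomial. -/
def addConst {q : ℕ} (D : ℤ) : List (ExpTerm q) → List (ExpTerm q)
  | [] => [⟨1, 0, 0, D⟩]
  | e :: p => if e.base = 1 ∧ e.deg = 0 then ⟨1, 0, e.coeff, e.const + D⟩ :: p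
      else e :: addConst D p

/-- Dominant term analysis. -/
def DTA {q : ℕ} : List (ExpTerm q) → QF q
  | [] => .le (.const 0) (.const 0)
  | e :: p =>
      .or (.le (.const 1) (.affine e.coeff e.const))
        (.and (.and (.le (.affine e.coeff e.const) (.const 0))
          (.le (.const 0) (.affine e.coeff e.const))) (DTA p))

/-- The row vectors `cᵀ Mᵏ`. -/
def rowPow {q : ℕ} (c : Fin q → ℤ) (M : Matrix (Fin q) (Fin q) ℚ) (k : ℕ) : Fin q → ℚ :=
  Matrix.vecMul (fun i => (c i : ℚ)) (M ^ k)

/-- `IsCharSeq M G H`: the sequence `H` is a characteristic sequence `χ(G, M)` of the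
quantifier-free formula `G`, computed by recursion on `G` (the closed forms and the residue
sequences that occur in it being arbitrary). -/
inductive IsCharSeq {q : ℕ} (M : Matrix (Fin q) (Fin q) ℚ) : QF q → (ℕ → QF q) → Prop
  /-- `t₁ ≤ t₂` is written as `cᵀx + d ≥ 0`; closed forms for the even and the odd powers. -/
  | le (t₁ t₂ : Term q) (Qe Qo : ℕ) (pe po : List (ExpTerm q))
      (he : IsClosedForm (fun k => rowPow (t₂.coeff - t₁.coeff) M (2 * k)) Qe pe)
      (ho : IsClosedForm (fun k => rowPow (t₂.coeff - t₁.coeff) M (2 * k + 1)) Qo po)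
      (hpe : IsDominanceOrdered pe) (hpo : IsDominanceOrdered po) :
      IsCharSeq M (.le t₁ t₂) fun k =>
        if k % 2 = 0 then DTA (addConst ((t₂.constPart - t₁.constPart) * Qe) pe)
        else DTA (addConst ((t₂.constPart - t₁.constPart) * Qo) po)
  /-- `n ∣ cᵀx + d`; the periodic sequence `z e` agrees with `λ^k k^d` modulo `Q n` for all but
  finitely many `k`. -/
  | dvd (n : ℤ) (t : Term q) (Q : ℕ) (p : List (ExpTerm q))
      (hp : IsClosedForm (fun k => rowPow t.coeff M k) Q p)
      (z : ExpTerm q → ℕ → ℤ)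
      (hper : ∀ e ∈ p, ∃ N : ℕ, 0 < N ∧ Function.Periodic (z e) N)
      (hz : ∀ e ∈ p, ∃ K : ℕ, ∀ k ≥ K, z e k ≡ e.base ^ k * (k : ℤ) ^ e.deg [ZMOD Q * n]) :
      IsCharSeq M (.dvd n t) fun k =>
        .dvd (Q * n) (.affine (p.map fun e => z e k • e.coeff).sum (Q * t.constPart))
  | and (G₁ G₂ : QF q) (H₁ H₂ : ℕ → QF q) (h₁ : IsCharSeq M G₁ H₁) (h₂ : IsCharSeq M G₂ H₂) :
      IsCharSeq M (.and G₁ G₂) fun k => .and (H₁ k) (H₂ k)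
  | or (G₁ G₂ : QF q) (H₁ H₂ : ℕ → QF q) (h₁ : IsCharSeq M G₁ H₁) (h₂ : IsCharSeq M G₂ H₂) :
      IsCharSeq M (.or G₁ G₂) fun k => .or (H₁ k) (H₂ k)
  | not (G : QF q) (H : ℕ → QF q) (h : IsCharSeq M G H) :
      IsCharSeq M (.not G) fun k => .not (H k)

/-- `(H 0, …, H (N - 1))^ω` is a characteristic sequence of the LIA formula `G` with respect to
`M`: it is computed from some quantifier-free formula that is equivalent to `G`. -/
def IsPeriodicCharSeq {q : ℕ} (G : Formula q) (M : Matrix (Fin q) (Fin q) ℚ)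
    (N : ℕ) (H : ℕ → QF q) : Prop :=
  0 < N ∧ Function.Periodic H N ∧
    ∃ G' : QF q, (∀ w, G'.toFormula.Sat w ↔ G.Sat w) ∧ IsCharSeq M G' H

/-! ### The mortal precondition operator -/

/-- `A`, the affine hull of the transition formula `F`. -/
def hull {n : ℕ} (F : Formula (n + n)) : Set ((Fin n → ℚ) × (Fin n → ℚ)) :=
  (affineSpan ℚ (tfRel F) : Set ((Fin n → ℚ) × (Fin n → ℚ)))

/-- The first phase of the procedure on `F`: the choice of a `ℚ-DATS`-reflection
`((V, rel), q)` of the determinization `(D, d)` of the affine hull `A` of `F`. -/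
structure Abstraction {n : ℕ} (F : Formula (n + n)) where
  V : Type
  [addCommGroup : AddCommGroup V]
  [module : Module ℚ V]
  [finiteDimensional : FiniteDimensional ℚ V]
  rel : Set (V × V)
  q : Module.Dual ℚ (det (hull F)) →ₗ[ℚ] V
  isReflection : IsReflection IsQDATS (alphaRel (det (hull F)) (hull F)) rel q

namespace Abstraction

attribute [instance] addCommGroup module finiteDimensional

variable {n : ℕ} {F : Formula (n + n)} (𝒜 : Abstraction F)

/-- The linear simulation `v = q ∘ d` from `F` to `V`. -/
def v : (Fin n → ℚ) →ₗ[ℚ] 𝒜.V := 𝒜.q ∘ₗ alphaMap (det (hull F))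

/-- The transition relation of `T`, the homogenization of `V`. -/
def T : Submodule ℚ ((𝒜.V × ℚ) × (𝒜.V × ℚ)) := homog 𝒜.rel

theorem deterministic : IsDeterministic (𝒜.T : Set ((𝒜.V × ℚ) × (𝒜.V × ℚ))) :=
  𝒜.isReflection.1.2.2.1

/-- The affine simulation `t = h ∘ v` from `F` to `T`. -/
def t (x : Fin n → ℚ) : 𝒜.V × ℚ := (𝒜.v x, 1)

/-- `ℤ(T)`. -/
def Z : Submodule ℚ (𝒜.V × ℚ) := intSpace 𝒜.T 𝒜.deterministic

/-- `T|_{ℤ(T)}`. -/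
def TZ : 𝒜.Z →ₗ[ℚ] 𝒜.Z := intMap 𝒜.T 𝒜.deterministic

end Abstraction

/-- The second phase: coordinates on `S_T` and on `ℤ(T)` in which the affine simulation
`t(x) = A x + b` and a linear projection `p` of `S_T` onto `ℤ(T)` are integral, and an integer
matrix `C` with kernel `ℤ(T)`. -/
structure Representation {n : ℕ} {F : Formula (n + n)} (𝒜 : Abstraction F) where
  m : ℕ
  basisT : Module.Basis (Fin m) ℚ (𝒜.V × ℚ)
  A : Matrix (Fin m) (Fin n) ℤ
  b : Fin m → ℤ
  t_eq : ∀ (x : Fin n → ℚ) (i : Fin m),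
    basisT.repr (𝒜.t x) i = ∑ j, (A i j : ℚ) * x j + (b i : ℚ)
  q : ℕ
  basisZ : Module.Basis (Fin q) ℚ 𝒜.Z
  proj : (𝒜.V × ℚ) →ₗ[ℚ] 𝒜.Z
  proj_apply : ∀ z : 𝒜.Z, proj z = z
  p : Matrix (Fin q) (Fin m) ℤ
  p_eq : ∀ (y : 𝒜.V × ℚ) (i : Fin q),
    basisZ.repr (proj y) i = ∑ j, (p i j : ℚ) * basisT.repr y j
  r : ℕ
  C : Matrix (Fin r) (Fin m) ℤ
  C_eq : ∀ y : 𝒜.V × ℚ, (∀ i, ∑ j, (C i j : ℚ) * basisT.repr y j = 0) ↔ y ∈ 𝒜.Z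

namespace Representation

variable {n : ℕ} {F : Formula (n + n)} {𝒜 : Abstraction F} (ρ : Representation 𝒜)

/-- The matrix of `T|_{ℤ(T)}`. -/
def M : Matrix (Fin ρ.q) (Fin ρ.q) ℚ := LinearMap.toMatrix ρ.basisZ ρ.basisZ 𝒜.TZ

/-- The term `p(t(x))_i`. -/
def ptTerm (i : Fin ρ.q) : Term n := .affine ((ρ.p * ρ.A) i) (ρ.p.mulVec ρ.b i)

/-- The formula `C t(x) = 0`. -/
def CtZero : Formula n :=
  .conj (List.ofFn fun i => .eq (.affine ((ρ.C * ρ.A) i) (ρ.C.mulVec ρ.b i)) (.const 0))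

/-- The formula `G(w) = ∃ x x'. F(x, x') ∧ w = p(t(x)) ∧ C t(x) = 0`; in its body, the variables
are listed in the order `w, x, x'`. -/
def G : Formula ρ.q :=
  .exs (n + n) <|
    .and (F.rename (Fin.natAdd ρ.q)) <|
      .and
        (.conj (List.ofFn fun i : Fin ρ.q =>
          .eq (.var (Fin.castAdd (n + n) i))
            ((ρ.ptTerm i).subst fun j => .var (Fin.natAdd ρ.q (Fin.castAdd n j)))))
        (ρ.CtZero.rename fun j => Fin.natAdd ρ.q (Fin.castAdd n j))

end Representation

/-- A run of the procedure on the transition formula `F`, with all the choices made on the way. -/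
structure Run {n : ℕ} (F : Formula (n + n)) where
  abstraction : Abstraction F
  representation : Representation abstraction
  N : ℕ
  H : ℕ → QF representation.q
  charSeq : IsPeriodicCharSeq representation.G representation.M N H

namespace Run

variable {n : ℕ} {F : Formula (n + n)} (run : Run F)

/-- The formula `¬ ((⋀ i, H_i(p(t(x)))) ∧ C t(x) = 0)` that the procedure returns. -/
def output : Formula n :=
  .not <| .and
    (.conj (List.ofFn fun i : Fin run.N =>
      ((run.H i).subst run.representation.ptTerm).toFormula))
    run.representation.CtZero

/-- The set `mp(F)` of states that this run computes. Non-integral states, which are not valuations,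
are included in it. -/
def mp : Set (Fin n → ℚ) :=
  {s | ∀ u : Fin n → ℤ, (s = fun i => (u i : ℚ)) → run.output.Sat u}

end Run

end MortalPrecondition

end

namespace MortalPrecondition

/-! Suppose an infinite computation `u 0, u 1, …` of `F` starts at `s`; its states are integer
vectors. The images `t (u k)` form a computation of the deterministic linear system `T`, and since
`t` is integral in the chosen coordinates, they all stay in one lattice.

The key point is that such a computation lies in `ℤ(T)` (`mem_intSpace_of_mem_lattice`). An orbit
inside a finitely generated group is killed by a monic integer polynomial. As the spectrum is
rational, the vector splits into generalized eigenvectors for rational roots of that polynomial, and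
these roots are integers.

Hence `C t (u k) = 0` for all `k`, and the integer vectors `w k = p (t (u k))` satisfy `w k = M ^ k
(w 0)`. Each `w k` satisfies `G`, witnessed by the transition from `u k` to `u (k + 1)`. Along an
integral orbit, `H k` at `w 0` agrees with `G` at `w k` for all but finitely many `k`
(`IsCharSeq.eventually_sat_iff`); periodicity of `H` removes the exceptions. So every `H i` holds at
`w 0`, and the returned formula, the negation of this conjunction, fails at `s`. -/

/-! ### Linear algebra: lattice orbits and integer eigenvalues -/

open Polynomial in
theorem coe_aeval_restrict_apply {W : Type} [AddCommGroup W] [Module ℚ W] (f : Module.End ℚ W)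
    (N : Submodule ℤ W) (hN : ∀ y ∈ N, f y ∈ N) (P : ℤ[X]) (y : N) :
    ((aeval ((f.restrictScalars ℤ).restrict hN) P y : N) : W) =
      aeval f (P.map (Int.castRingHom ℚ)) y := by
  have hpow (k : ℕ) : ((((f.restrictScalars ℤ).restrict hN) ^ k) y : W) = (f ^ k) (y : W) := by
    induction k with
    | zero => rfl
    | succ k ih => simp only [pow_succ', Module.End.mul_apply, ← ih]; rfl
  induction P using Polynomial.induction_on' with
  | add p q hp hq => simp [hp, hq]
  | monomial k a =>
    simp only [aeval_monomial, map_monomial, Module.End.mul_apply]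
    rw [← hpow]
    simp

open Polynomial in
/-- A vector whose orbit stays in a finitely generated group is killed by a monic integer
polynomial. -/
theorem exists_monic_int_aeval_apply_eq_zero {W : Type} [AddCommGroup W] [Module ℚ W]
    (f : Module.End ℚ W) (x : W) (L : Submodule ℤ W) (hL : L.FG) (hx : ∀ k, (f ^ k) x ∈ L) :
    ∃ P : ℤ[X], P.Monic ∧ aeval f (P.map (Int.castRingHom ℚ)) x = 0 := by
  -- `L` need not be stable under `f`, but the span of the orbit is. It is still finitely generated
  -- because `ℤ` is Noetherian, so `f` acts on it as an endomorphism integral over `ℤ`.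
  let N : Submodule ℤ W := Submodule.span ℤ (Set.range fun k => (f ^ k) x)
  have hNL : N ≤ L := Submodule.span_le.mpr (by rintro _ ⟨k, rfl⟩; exact hx k)
  have hN : ∀ y ∈ N, f y ∈ N := by
    intro y hy
    induction hy using Submodule.span_induction with
    | mem y h =>
      obtain ⟨k, rfl⟩ := h
      exact Submodule.subset_span ⟨k + 1, by simp [pow_succ']⟩
    | zero => simp
    | add y z _ _ hy hz => rw [map_add]; exact N.add_mem hy hz
    | smul c y _ hy => rw [map_zsmul]; exact N.smul_mem c hy
  have : Module.Finite ℤ L := Module.Finite.iff_fg.mpr hL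
  have : Module.Finite ℤ N :=
    Module.Finite.of_injective (Submodule.inclusion hNL) (Submodule.inclusion_injective hNL)
  obtain ⟨P, hP, h⟩ := Algebra.IsIntegral.isIntegral (R := ℤ) ((f.restrictScalars ℤ).restrict hN)
  refine ⟨P, hP, ?_⟩
  have hxN : x ∈ N := Submodule.subset_span ⟨0, by simp⟩
  rw [← coe_aeval_restrict_apply f N hN P ⟨x, hxN⟩, aeval_def, h]
  simp

-- Primary decomposition: the factors are pairwise coprime, so the kernel of their product is the
-- sum of their kernels, and each of these lies in `V`.
open Polynomial in
theorem mem_of_aeval_prod_X_sub_C_pow {W : Type} [AddCommGroup W] [Module ℚ W]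
    (f : Module.End ℚ W) (V : Submodule ℚ W) (m : ℚ → ℕ) (s : Finset ℚ)
    (hV : ∀ a ∈ s, ∀ y, ((f - algebraMap ℚ (Module.End ℚ W) a) ^ m a) y = 0 → y ∈ V) (x : W)
    (hx : aeval f (∏ a ∈ s, (X - C a) ^ m a) x = 0) : x ∈ V := by
  induction s using Finset.induction_on generalizing x with
  | empty => simp only [Finset.prod_empty, map_one, Module.End.one_apply] at hx; simp [hx]
  | insert a s ha ih =>
    rw [Finset.prod_insert ha, ← LinearMap.mem_ker,
      ← sup_ker_aeval_eq_ker_aeval_mul_of_coprime] at hx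
    · obtain ⟨y, hy, z, hz, rfl⟩ := Submodule.mem_sup.mp hx
      refine V.add_mem (hV a (by simp) y ?_)
        (ih (fun b hb => hV b (Finset.mem_insert_of_mem hb)) z hz)
      simpa using hy
    · refine IsCoprime.prod_right fun b hb => IsCoprime.pow ?_
      exact pairwise_coprime_X_sub_C Function.injective_id fun h => ha (h ▸ hb)

open Polynomial in
/-- If all complex eigenvalues of `f` are rational, then a vector whose orbit stays in a lattice is
a sum of generalized eigenvectors for integer eigenvalues. -/
theorem mem_of_orbit_mem_lattice {W : Type} [AddCommGroup W] [Module ℚ W] [FiniteDimensional ℚ W]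
    (f : Module.End ℚ W) (hf : ∀ z ∈ spec f, ∃ r : ℚ, z = (r : ℂ))
    (V : Submodule ℚ W)
    (hV : ∀ r : ℕ, 0 < r → ∀ l : ℤ, ∀ y, ((f - (l : Module.End ℚ W)) ^ r) y = 0 → y ∈ V)
    (x : W) (L : Submodule ℤ W) (hL : L.FG) (hx : ∀ k, (f ^ k) x ∈ L) : x ∈ V := by
  obtain ⟨P, hP, hPx⟩ := exists_monic_int_aeval_apply_eq_zero f x L hL hx
  have hsplit : f.charpoly.Splits := by
    refine Splits.of_splits_map (algebraMap ℚ ℂ) (IsAlgClosed.splits _) fun z hz => ?_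
    obtain ⟨r, rfl⟩ := hf z (by
      have := (mem_roots'.mp hz).2
      rwa [IsRoot, eval_map_algebraMap] at this)
    exact ⟨r, rfl⟩
  -- By Bézout and Cayley–Hamilton, `g` evaluated at `f` kills `x`. Dividing `f.charpoly`, it splits
  -- over `ℚ`; dividing `P`, it has only integer roots by the rational root theorem.
  set g := EuclideanDomain.gcd (P.map (Int.castRingHom ℚ)) f.charpoly with hg
  have hgP : g ∣ P.map (Int.castRingHom ℚ) := EuclideanDomain.gcd_dvd_left _ _
  have hgf : g ∣ f.charpoly := EuclideanDomain.gcd_dvd_right _ _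
  have hg0 : g ≠ 0 := fun h => f.charpoly_monic.ne_zero (by rwa [h, zero_dvd_iff] at hgf)
  have hgx : aeval f g x = 0 := by
    rw [hg, EuclideanDomain.gcd_eq_gcd_ab, mul_comm, mul_comm f.charpoly]
    simp [hPx, LinearMap.aeval_self_charpoly]
  have hgs := hsplit.of_dvd f.charpoly_monic.ne_zero hgf
  rw [hgs.eq_prod_roots, Finset.prod_multiset_map_count] at hgx
  refine mem_of_aeval_prod_X_sub_C_pow f V (fun a => g.roots.count a) g.roots.toFinset ?_ x ?_
  · intro a ha y hy
    rw [Multiset.mem_toFinset] at ha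
    have hroot : aeval a P = 0 := by
      have := ((mem_roots hg0).mp ha).dvd hgP
      rwa [IsRoot, eval_map, ← algebraMap_int_eq, ← aeval_def] at this
    obtain ⟨l, rfl⟩ := isInteger_of_is_root_of_monic hP hroot
    refine hV _ (Multiset.count_pos.mpr ha) l y ?_
    convert hy using 5
    ext v
    simp
  · have h0 : g.leadingCoeff ≠ 0 := leadingCoeff_ne_zero.mpr hg0
    rw [map_mul, aeval_C, Module.End.mul_apply, Module.algebraMap_end_apply] at hgx
    exact (smul_eq_zero.mp hgx).resolve_left h0

/-! ### Semantics of terms and formulas -/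

namespace Term

theorem eval_subst {n m : ℕ} (σ : Fin n → Term m) (v : Fin m → ℤ) (t : Term n) :
    (t.subst σ).eval v = t.eval fun i => (σ i).eval v := by
  induction t <;> simp_all [subst, eval]

theorem eval_eq_coeff {n : ℕ} (v : Fin n → ℤ) (t : Term n) :
    t.eval v = t.coeff ⬝ᵥ v + t.constPart := by
  induction t with
  | var i => simp [eval, coeff, constPart]
  | const c => simp [eval, coeff, constPart]
  | smul c t ih => rw [eval, coeff, constPart, ih, smul_dotProduct, smul_eq_mul, mul_add]
  | add t s iht ihs => simp [eval, coeff, constPart, iht, ihs, add_dotProduct]; ring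

theorem eval_affine {n : ℕ} (a : Fin n → ℤ) (c : ℤ) (v : Fin n → ℤ) :
    (affine a c).eval v = a ⬝ᵥ v + c := by
  have h (l : List (Term n)) :
      (l.foldr add (const c)).eval v = (l.map (eval v)).sum + c := by
    induction l with
    | nil => simp [eval]
    | cons t l ih => simp [eval, ih, add_assoc]
  rw [affine, h, List.map_ofFn, List.sum_ofFn]
  rfl

end Term

namespace Formula

theorem sat_rename {n m : ℕ} (f : Fin n → Fin m) (φ : Formula n) (v : Fin m → ℤ) :
    (φ.rename f).Sat v ↔ φ.Sat (v ∘ f) := by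
  have key {n m : ℕ} (f : Fin n → Fin m) (v : Fin m → ℤ) (z : ℤ) :
      (Fin.snoc (α := fun _ => ℤ) v z) ∘
        (Fin.snoc (α := fun _ => Fin (m + 1)) (fun i => (f i).castSucc) (Fin.last m)) =
      Fin.snoc (α := fun _ => ℤ) (v ∘ f) z := by
    funext i
    refine Fin.lastCases ?_ (fun i => ?_) i <;> simp
  induction φ generalizing m with
  | le t s => simp [rename, Sat, Term.eval_subst, Term.eval, Function.comp_def]
  | dvd c t => simp [rename, Sat, Term.eval_subst, Term.eval, Function.comp_def]
  | and φ ψ h₁ h₂ => simp [rename, Sat, h₁, h₂]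
  | or φ ψ h₁ h₂ => simp [rename, Sat, h₁, h₂]
  | not φ h => simp [rename, Sat, h]
  | ex φ h => simp only [rename, Sat, h, key]
  | all φ h => simp only [rename, Sat, h, key]

theorem sat_exs_of_sat {m : ℕ} (k : ℕ) (φ : Formula (m + k)) (v : Fin m → ℤ) (u : Fin k → ℤ)
    (h : φ.Sat (Fin.append v u)) : (exs k φ).Sat v := by
  induction k with
  | zero =>
    have : Fin.append v u = v := by
      funext i
      exact Fin.append_left v u i
    rwa [this] at h
  | succ k ih =>
    -- The last variable is bound by the innermost quantifier, so its value is split off first.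
    have hu : Fin.snoc (α := fun _ => ℤ) (Fin.append v (Fin.init u)) (u (Fin.last k)) =
        Fin.append v u := by
      rw [← Fin.append_snoc, Fin.snoc_init_self]
    exact ih (.ex φ) (Fin.init u) ⟨u (Fin.last k), hu ▸ h⟩

theorem sat_eq {n : ℕ} (t s : Term n) (v : Fin n → ℤ) :
    (eq t s).Sat v ↔ t.eval v = s.eval v :=
  le_antisymm_iff.symm

theorem sat_conj {n : ℕ} (l : List (Formula n)) (v : Fin n → ℤ) :
    (conj l).Sat v ↔ ∀ φ ∈ l, φ.Sat v := by
  induction l with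
  | nil => simp [conj, Sat]
  | cons φ l ih =>
    simp only [conj, List.foldr_cons, Sat, List.mem_cons, forall_eq_or_imp] at ih ⊢
    rw [ih]

end Formula

theorem QF.sat_subst {n m : ℕ} (σ : Fin n → Term m) (φ : QF n) (v : Fin m → ℤ) :
    (φ.subst σ).toFormula.Sat v ↔ φ.toFormula.Sat fun i => (σ i).eval v := by
  induction φ <;> simp_all [QF.subst, QF.toFormula, Formula.Sat, Term.eval_subst]

/-! ### Exponential polynomials -/

namespace ExpTerm

variable {q : ℕ}

/-- The integer `aᵀw + c`. -/
def form (e : ExpTerm q) (w : Fin q → ℤ) : ℤ := e.coeff ⬝ᵥ w + e.const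

/-- The integer `λ^k k^d (aᵀw + c)`. -/
def value (e : ExpTerm q) (w : Fin q → ℤ) (k : ℕ) : ℤ :=
  e.base ^ k * (k : ℤ) ^ e.deg * e.form w

end ExpTerm

section Growth

variable {q : ℕ}

-- A strictly larger base beats every power of `k`, and the extra factor `k ^ d` is at least `1`
-- once `k ≥ 1`. For equal bases the powers of `k` decide.
open Filter Asymptotics in
theorem isLittleO_growth {a b c d : ℕ} (h : a < b ∨ a = b ∧ c < d) (hb : 0 < b) :
    (fun k : ℕ => (a : ℝ) ^ k * (k : ℝ) ^ c) =o[atTop] fun k : ℕ => (b : ℝ) ^ k * (k : ℝ) ^ d := by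
  rcases h with h | ⟨rfl, h⟩
  · have h₁ := isLittleO_pow_const_mul_const_pow_const_pow_of_norm_lt (R := ℝ) c
      (r₁ := (a : ℝ)) (r₂ := b) (by simpa using h)
    refine (h₁.congr_left fun k => mul_comm _ _).trans_isBigO ?_
    refine IsBigO.of_bound 1 ?_
    filter_upwards [eventually_ge_atTop 1] with k hk
    have hk : (1 : ℝ) ≤ (k : ℝ) ^ d := one_le_pow₀ (by exact_mod_cast hk)
    rw [one_mul, norm_mul]
    refine le_mul_of_one_le_right (norm_nonneg _) (hk.trans (le_abs_self _))
  · refine (isBigO_refl _ _).mul_isLittleO ?_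
    exact ((isLittleO_pow_pow_atTop_of_lt (𝕜 := ℝ) h).comp_tendsto tendsto_natCast_atTop_atTop)

open Filter Asymptotics in
/-- The leading summand dominates the others. -/
theorem eventually_abs_sum_lt (e : ExpTerm q) (p : List (ExpTerm q))
    (hp : IsDominanceOrdered (e :: p)) (w : Fin q → ℤ) :
    ∀ᶠ k : ℕ in atTop, |(p.map fun f => f.value w k).sum| < e.base ^ k * (k : ℤ) ^ e.deg := by
  obtain ⟨hpos, hlt⟩ := hp
  rw [List.pairwise_cons] at hlt
  have he := hpos e (by simp)
  have h : (fun k : ℕ => (((p.map fun f => f.value w k).sum : ℤ) : ℝ)) =o[atTop]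
      fun k : ℕ => (e.base : ℝ) ^ k * (k : ℝ) ^ e.deg := by
    have hlt := hlt.1
    have hpos : ∀ f ∈ p, 0 < f.base := fun f hf => hpos f (by simp [hf])
    clear * - he hlt hpos
    induction p with
    | nil => simp
    | cons f p ih =>
      simp only [List.map_cons, List.sum_cons, Int.cast_add]
      refine IsLittleO.add ?_
        (ih (fun g hg => hlt g (by simp [hg])) fun g hg => hpos g (by simp [hg]))
      have hf := hpos f (by simp)
      have hfe := hlt f (by simp)
      obtain ⟨a, ha⟩ := Int.eq_ofNat_of_zero_le hf.le
      obtain ⟨b, hb⟩ := Int.eq_ofNat_of_zero_le he.le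
      have := isLittleO_growth (a := a) (b := b) (c := f.deg) (d := e.deg) (by omega) (by omega)
      simp only [ExpTerm.value, Int.cast_mul, Int.cast_pow, Int.cast_natCast, ha, hb]
      simpa [mul_comm] using this.const_mul_left ((f.form w : ℤ) : ℝ)
  -- Any constant below `1` would turn the little-o bound into a strict inequality; `k ≥ 1` keeps `k
  -- ^ e.deg` positive.
  filter_upwards [h.bound (c := 1 / 2) (by norm_num), eventually_ge_atTop 1] with k hk hk1
  have hk0 : (0 : ℝ) < (k : ℝ) := by exact_mod_cast hk1
  have he' : (0 : ℝ) < e.base := by exact_mod_cast he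
  have hB : 0 < (e.base : ℝ) ^ k * (k : ℝ) ^ e.deg := by positivity
  rw [Real.norm_eq_abs, Real.norm_eq_abs, abs_of_pos hB] at hk
  have : |(((p.map fun f => f.value w k).sum : ℤ) : ℝ)| < (e.base : ℝ) ^ k * (k : ℝ) ^ e.deg := by
    linarith
  exact_mod_cast this

-- The leading form takes an integer value at `w`. If it is nonzero, its absolute value is at least
-- `1`, so the leading summand outweighs the rest and fixes the sign of the sum; if it is zero, the
-- summand vanishes and the tail decides.
open Filter in
theorem eventually_sat_DTA_iff (p : List (ExpTerm q)) (hp : IsDominanceOrdered p)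
    (w : Fin q → ℤ) :
    ∀ᶠ k : ℕ in atTop, (DTA p).toFormula.Sat w ↔ 0 ≤ (p.map fun e => e.value w k).sum := by
  induction p with
  | nil => simp [DTA, QF.toFormula, Formula.Sat]
  | cons e p ih =>
    have hp' : IsDominanceOrdered p :=
      ⟨fun f hf => hp.1 f (by simp [hf]), (List.pairwise_cons.mp hp.2).2⟩
    filter_upwards [ih hp', eventually_abs_sum_lt e p hp w] with k hk hlt
    simp only [DTA, QF.toFormula, Formula.Sat, Term.eval_affine, Term.eval, List.map_cons,
      List.sum_cons, hk, ← le_antisymm_iff]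
    change 1 ≤ e.form w ∨ e.form w = 0 ∧ _ ↔ 0 ≤ e.base ^ k * (k : ℤ) ^ e.deg * e.form w + _
    set B := e.base ^ k * (k : ℤ) ^ e.deg
    set R := (p.map fun e => e.value w k).sum
    have hB : 0 < B := (abs_nonneg _).trans_lt hlt
    have hR := abs_lt.mp hlt
    rcases lt_trichotomy (e.form w) 0 with h | h | h
    · have : B * e.form w + R < 0 := by nlinarith
      constructor
      · rintro (h' | h') <;> omega
      · intro; omega
    · simp [h]
    · have : 0 ≤ B * e.form w + R := by nlinarith
      exact iff_of_true (Or.inl h) this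

theorem sum_addConst (D : ℤ) (p : List (ExpTerm q)) (w : Fin q → ℤ) (k : ℕ) :
    ((addConst D p).map fun e => e.value w k).sum = (p.map fun e => e.value w k).sum + D := by
  induction p with
  | nil => simp [addConst, ExpTerm.value, ExpTerm.form]
  | cons e p ih =>
    rw [addConst]
    split_ifs with h
    · simp [ExpTerm.value, ExpTerm.form, h.1, h.2]; ring
    · simp [ih, add_assoc]

theorem mem_addConst {D : ℤ} {p : List (ExpTerm q)} {f : ExpTerm q} (h : f ∈ addConst D p) :
    (f.base = 1 ∧ f.deg = 0) ∨ f ∈ p := by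
  induction p with
  | nil => simp only [addConst, List.mem_singleton] at h; simp [h]
  | cons e p ih =>
    rw [addConst] at h
    split_ifs at h with h'
    · rcases List.mem_cons.mp h with rfl | h
      · simp
      · simp [h]
    · rcases List.mem_cons.mp h with rfl | h
      · simp
      · rcases ih h with h | h <;> simp [h]

/-- Among summands with positive integer base, `1 ^ k * k ^ 0` grows slowest. The constant therefore
belongs at the end, or merges with a summand of the same growth. -/
theorem IsDominanceOrdered.addConst {p : List (ExpTerm q)} (hp : IsDominanceOrdered p) (D : ℤ) :
    IsDominanceOrdered (addConst D p) := by
  refine ⟨fun f hf => ?_, ?_⟩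
  · rcases mem_addConst hf with h | h
    · omega
    · exact hp.1 f h
  · obtain ⟨hpos, hlt⟩ := hp
    induction p with
    | nil => simp [MortalPrecondition.addConst]
    | cons e p ih =>
      rw [List.pairwise_cons] at hlt
      rw [MortalPrecondition.addConst]
      split_ifs with h
      · refine List.pairwise_cons.mpr ⟨fun f hf => ?_, hlt.2⟩
        simpa [h] using hlt.1 f hf
      · refine List.pairwise_cons.mpr ⟨fun f hf => ?_,
          ih (fun f hf => hpos f (by simp [hf])) hlt.2⟩
        rcases mem_addConst hf with hf | hf
        · have := hpos e (by simp)
          omega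
        · exact hlt.1 f hf

end Growth

/-! ### Characteristic sequences -/

section CharSeq

variable {q : ℕ} {M : Matrix (Fin q) (Fin q) ℚ}

/-- The integer vector `y` is `Mᵏ w`. -/
def IsPowImage (M : Matrix (Fin q) (Fin q) ℚ) (w : Fin q → ℤ) (k : ℕ) (y : Fin q → ℤ) : Prop :=
  (fun i => (y i : ℚ)) = (M ^ k).mulVec fun i => (w i : ℚ)

theorem rowPow_dotProduct (c w y : Fin q → ℤ) (k : ℕ) (h : IsPowImage M w k y) :
    rowPow c M k ⬝ᵥ (fun i => (w i : ℚ)) = ((c ⬝ᵥ y : ℤ) : ℚ) := by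
  rw [rowPow, ← Matrix.dotProduct_mulVec, ← h]
  simp [dotProduct]

/-- Pairing the row vectors with `w` gives an equation over `ℚ` whose two sides are integers,
because the orbit is integral. The reindexing `j` is the identity for divisibility atoms, and `2 *
k` or `2 * k + 1` for inequalities. -/
theorem IsClosedForm.eventually_eq {c : Fin q → ℤ} {j : ℕ → ℕ} {Q : ℕ} {p : List (ExpTerm q)}
    (hp : IsClosedForm (fun k => rowPow c M (j k)) Q p) {w : Fin q → ℤ} {y : ℕ → Fin q → ℤ}
    (hy : ∀ k, IsPowImage M w k (y k)) :
    ∀ᶠ k : ℕ in Filter.atTop,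
      (Q : ℤ) * (c ⬝ᵥ y (j k)) = (p.map fun e => e.value w k).sum := by
  obtain ⟨-, hconst, K, hK⟩ := hp
  filter_upwards [Filter.eventually_ge_atTop K] with k hk
  have h₁ : (Q : ℚ) * (rowPow c M (j k) ⬝ᵥ fun i => (w i : ℚ)) =
      (((p.map fun e => e.value w k).sum : ℤ) : ℚ) := by
    have h₂ : (Q : ℚ) * (rowPow c M (j k) ⬝ᵥ fun i => (w i : ℚ)) =
        (fun i => (p.map fun e =>
          (e.base : ℚ) ^ k * (k : ℚ) ^ e.deg * (e.coeff i : ℚ)).sum) ⬝ᵥ fun i => (w i : ℚ) := by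
      simp only [dotProduct, Finset.mul_sum, ← mul_assoc, hK k hk]
    rw [h₂]
    clear * - hconst
    induction p with
    | nil => simp [dotProduct]
    | cons e p ih =>
      have ih := ih fun f hf => hconst f (by simp [hf])
      simp only [List.map_cons, List.sum_cons, Int.cast_add, ← ih]
      simp only [dotProduct, add_mul, Finset.sum_add_distrib, ExpTerm.value, ExpTerm.form,
        hconst e (by simp)]
      push_cast [dotProduct]
      simp only [add_zero, Finset.mul_sum, mul_assoc]
  rw [rowPow_dotProduct c w (y (j k)) (j k) (hy _)] at h₁
  exact_mod_cast h₁

-- Multiplication by `Q > 0` preserves the sign and turns the constant `d` into `d * Q`.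
open Filter in
theorem eventually_sat_DTA_addConst {c : Fin q → ℤ} {d : ℤ} {j : ℕ → ℕ} {Q : ℕ}
    {p : List (ExpTerm q)} (hp : IsClosedForm (fun k => rowPow c M (j k)) Q p)
    (hd : IsDominanceOrdered p) {w : Fin q → ℤ} {y : ℕ → Fin q → ℤ}
    (hy : ∀ k, IsPowImage M w k (y k)) :
    ∀ᶠ k : ℕ in atTop, (DTA (addConst (d * Q) p)).toFormula.Sat w ↔ 0 ≤ c ⬝ᵥ y (j k) + d := by
  filter_upwards [hp.eventually_eq hy, eventually_sat_DTA_iff _ (hd.addConst (d * Q)) w]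
    with k h₁ h₂
  have hQ : (0 : ℤ) < Q := by exact_mod_cast hp.1
  rw [h₂, sum_addConst, ← h₁, mul_comm d, ← mul_add, mul_nonneg_iff_of_pos_left hQ]

theorem dotProduct_sum_modEq {N : ℤ} (p : List (ExpTerm q)) (hp : ∀ e ∈ p, e.const = 0)
    (z : ExpTerm q → ℤ) (w : Fin q → ℤ) (k : ℕ)
    (hz : ∀ e ∈ p, z e ≡ e.base ^ k * (k : ℤ) ^ e.deg [ZMOD N]) :
    (p.map fun e => z e • e.coeff).sum ⬝ᵥ w ≡ (p.map fun e => e.value w k).sum [ZMOD N] := by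
  induction p with
  | nil => simp
  | cons e p ih =>
    simp only [List.map_cons, List.sum_cons, add_dotProduct, smul_dotProduct, smul_eq_mul]
    refine Int.ModEq.add ?_ (ih (fun f hf => hp f (by simp [hf])) fun f hf => hz f (by simp [hf]))
    rw [ExpTerm.value, ExpTerm.form, hp e (by simp), add_zero]
    exact (hz e (by simp)).mul_right _

open Filter in
/-- Along an integral orbit of `M`, the truth values of `G` agree with those of a characteristic
sequence of `G` at the initial point, except for finitely many indices. -/
theorem IsCharSeq.eventually_sat_iff {G : QF q} {H : ℕ → QF q} (h : IsCharSeq M G H)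
    {w : Fin q → ℤ} {y : ℕ → Fin q → ℤ} (hy : ∀ k, IsPowImage M w k (y k)) :
    ∀ᶠ k : ℕ in atTop, (H k).toFormula.Sat w ↔ G.toFormula.Sat (y k) := by
  induction h with
  | le t₁ t₂ Qe Qo pe po he ho hpe hpo =>
    have h₀ := eventually_sat_DTA_addConst (j := fun k => 2 * k)
      (d := t₂.constPart - t₁.constPart) he hpe hy
    have h₁ := eventually_sat_DTA_addConst (j := fun k => 2 * k + 1)
      (d := t₂.constPart - t₁.constPart) ho hpo hy
    -- The parity split allows positive bases even if `M` has negative eigenvalues. Index `k` is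
    -- governed by the closed form for its parity at `k / 2`, which tends to infinity, so finitely
    -- many exceptions remain finitely many.
    have hdiv : Tendsto (fun k : ℕ => k / 2) atTop atTop := Nat.tendsto_div_const_atTop two_ne_zero
    have hle (v : Fin q → ℤ) : (QF.le t₁ t₂).toFormula.Sat v ↔
        0 ≤ (t₂.coeff - t₁.coeff) ⬝ᵥ v + (t₂.constPart - t₁.constPart) := by
      simp only [QF.toFormula, Formula.Sat, Term.eval_eq_coeff, sub_dotProduct]
      omega
    filter_upwards [hdiv.eventually h₀, hdiv.eventually h₁] with k h₀ h₁
    rw [hle]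
    split_ifs with hk
    · rwa [show 2 * (k / 2) = k by omega] at h₀
    · rwa [show 2 * (k / 2) + 1 = k by omega] at h₁
  | dvd n t Q p hp z hper hz =>
    have hz : ∀ᶠ k : ℕ in atTop, ∀ e ∈ p, z e k ≡ e.base ^ k * (k : ℤ) ^ e.deg [ZMOD Q * n] := by
      clear * - hz
      induction p with
      | nil => simp
      | cons e p ih =>
        obtain ⟨K, hK⟩ := hz e (by simp)
        filter_upwards [ih fun f hf => hz f (by simp [hf]), eventually_ge_atTop K] with k h₁ h₂
        simpa using ⟨hK k h₂, h₁⟩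
    filter_upwards [hp.eventually_eq (j := id) hy, hz] with k h₁ h₂
    have hQ : (Q : ℤ) ≠ 0 := by exact_mod_cast hp.1.ne'
    simp only [QF.toFormula, Formula.Sat]
    -- Since `Q ≠ 0`, divisibility of an integer by `n` is divisibility of its `Q`-fold by `Q * n`.
    -- This is why the residues are taken modulo `Q * n`.
    have h₃ := (dotProduct_sum_modEq p hp.2.1 (fun e => z e k) w k h₂).add_right (Q * t.constPart)
    rw [← h₁, ← mul_add] at h₃
    rw [Term.eval_affine, Term.eval_eq_coeff, h₃.dvd_iff, mul_dvd_mul_iff_left hQ]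
    rfl
  | and G₁ G₂ H₁ H₂ _ _ ih₁ ih₂ =>
    filter_upwards [ih₁, ih₂] with k h₁ h₂
    simp only [QF.toFormula, Formula.Sat, h₁, h₂]
  | or G₁ G₂ H₁ H₂ _ _ ih₁ ih₂ =>
    filter_upwards [ih₁, ih₂] with k h₁ h₂
    simp only [QF.toFormula, Formula.Sat, h₁, h₂]
  | not G H _ ih =>
    filter_upwards [ih] with k h
    simp only [QF.toFormula, Formula.Sat, h]

/-- Each `H i` recurs at `i + K * N`, which is at least `K` because `N > 0`, hence beyond all
exceptional indices. -/
theorem IsPeriodicCharSeq.sat_of_forall_sat {G : Formula q} {N : ℕ} {H : ℕ → QF q}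
    (h : IsPeriodicCharSeq G M N H) {w : Fin q → ℤ} {y : ℕ → Fin q → ℤ}
    (hy : ∀ k, IsPowImage M w k (y k)) (hG : ∀ k, G.Sat (y k)) (i : ℕ) :
    (H i).toFormula.Sat w := by
  obtain ⟨hN, hper, G', hG', hH⟩ := h
  obtain ⟨K, hK⟩ := Filter.eventually_atTop.mp (hH.eventually_sat_iff hy)
  have hi : H (i + K * N) = H i := by simpa using hper.nat_mul K i
  rw [← hi, hK (i + K * N) (by nlinarith), hG']
  exact hG _

end CharSeq

/-! ### Computations of deterministic linear systems -/

section Orbits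

variable {S : Type} [AddCommGroup S] [Module ℚ S]

theorem inducedMap_eq (L : Submodule ℚ (S × S)) (hL : IsDeterministic (L : Set (S × S)))
    (W : Submodule ℚ S) (hW : ∀ x ∈ W, ∃ y ∈ W, (x, y) ∈ L) (x y : W)
    (h : ((x : S), (y : S)) ∈ L) : inducedMap L hL W hW x = y :=
  Subtype.ext (hL _ _ _ (inducedMap_mem L hL W hW x) h)

/-- Determinism leaves one possible successor, so a computation inside `W` is the orbit of its first
state. -/
theorem inducedMap_pow_eq (L : Submodule ℚ (S × S)) (hL : IsDeterministic (L : Set (S × S)))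
    (W : Submodule ℚ S) (hW : ∀ x ∈ W, ∃ y ∈ W, (x, y) ∈ L) (g : ℕ → W)
    (h : ∀ k, ((g k : S), (g (k + 1) : S)) ∈ L) (k : ℕ) :
    ((inducedMap L hL W hW) ^ k) (g 0) = g k := by
  induction k with
  | zero => rfl
  | succ k ih => rw [pow_succ', Module.End.mul_apply, ih, inducedMap_eq L hL W hW _ _ (h k)]

/-- A computation of a deterministic linear transition system with rational spectrum that stays
in a lattice lies in `ℤ(T)`. -/
theorem mem_intSpace_of_mem_lattice [FiniteDimensional ℚ S] (L : Submodule ℚ (S × S))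
    (hL : IsDeterministic (L : Set (S × S))) (hq : IsQDLTS L) (N : Submodule ℤ S) (hN : N.FG)
    (g : ℕ → S) (hg : ∀ k, (g k, g (k + 1)) ∈ L) (hgN : ∀ k, g k ∈ N) (k : ℕ) :
    g k ∈ intSpace L hL := by
  have hω (k : ℕ) : g k ∈ omegaSpace L :=
    ⟨fun j => g (k + j), rfl, fun j => hg (k + j)⟩
  obtain ⟨_, hspec⟩ := hq
  -- The spectral hypothesis concerns the map on the `ω`-domain, so the lattice is pulled back
  -- there. The pullback embeds in `N`, hence is finitely generated.
  let ι : omegaSpace L →ₗ[ℤ] S := (omegaSpace L).subtype.restrictScalars ℤ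
  have : Module.Finite ℤ N := Module.Finite.iff_fg.mpr hN
  have hfin : (N.comap ι).FG := by
    rw [← Module.Finite.iff_fg]
    refine Module.Finite.of_injective (ι.restrict (p := N.comap ι) (q := N) fun _ h => h) ?_
    intro x y h
    exact Subtype.ext (Subtype.ext (congrArg (fun z : N => (z : S)) h))
  refine mem_of_orbit_mem_lattice (omegaMap L hL) hspec ((intSpace L hL).comap
    (omegaSpace L).subtype) (fun r hr l y hy => ?_) ⟨g k, hω k⟩ (N.comap ι) hfin fun j => ?_
  · exact Submodule.subset_span ⟨y.2, r, hr, l, hy⟩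
  · have := inducedMap_pow_eq L hL _ (exists_succ_omegaSpace L)
      (fun j => ⟨g (k + j), hω (k + j)⟩) (fun j => hg (k + j)) j
    change ((omegaMap L hL) ^ j) _ = _ at this
    simp only [Submodule.mem_comap]
    rw [show (⟨g k, hω k⟩ : omegaSpace L) = ⟨g (k + 0), hω (k + 0)⟩ from rfl, this]
    exact hgN (k + j)

end Orbits

/-! ### The abstraction of `F` in integral coordinates -/

variable {n : ℕ} {F : Formula (n + n)}

/-- A chain of simulations: from `F` to its affine hull, to the determinization, to `V`, and to the
generators of the homogenization. -/
theorem Abstraction.t_mem_T (𝒜 : Abstraction F) {x x' : Fin n → ℚ} (h : (x, x') ∈ tfRel F) :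
    (𝒜.t x, 𝒜.t x') ∈ 𝒜.T :=
  Submodule.subset_span ⟨𝒜.v x, 𝒜.v x', 𝒜.isReflection.2.1 _ _
    ⟨x, x', subset_affineSpan ℚ (tfRel F) h, rfl⟩, rfl⟩

namespace Representation

variable {𝒜 : Abstraction F} (ρ : Representation 𝒜)

theorem repr_t (u : Fin n → ℤ) (j : Fin ρ.m) :
    ρ.basisT.repr (𝒜.t fun i => (u i : ℚ)) j = ((ρ.A.mulVec u j + ρ.b j : ℤ) : ℚ) := by
  rw [ρ.t_eq]
  simp [Matrix.mulVec, dotProduct]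

/-- Used with `B` equal to `p` and to `C`: it identifies the terms written in the formulas with the
coordinates of the linear algebra. -/
theorem sum_mul_repr_t {k : ℕ} (B : Matrix (Fin k) (Fin ρ.m) ℤ) (u : Fin n → ℤ) (i : Fin k) :
    ∑ j, (B i j : ℚ) * ρ.basisT.repr (𝒜.t fun i => (u i : ℚ)) j =
      ((Term.affine ((B * ρ.A) i) (B.mulVec ρ.b i)).eval u : ℚ) := by
  have h : (Term.affine ((B * ρ.A) i) (B.mulVec ρ.b i)).eval u =
      B.mulVec (ρ.A.mulVec u + ρ.b) i := by
    rw [Term.eval_affine, Matrix.mulVec_add, Matrix.mulVec_mulVec]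
    rfl
  simp only [h, ρ.repr_t]
  simp [Matrix.mulVec, dotProduct]

theorem eval_ptTerm (u : Fin n → ℤ) (i : Fin ρ.q) :
    ((ρ.ptTerm i).eval u : ℚ) = ρ.basisZ.repr (ρ.proj (𝒜.t fun i => (u i : ℚ))) i := by
  rw [ρ.p_eq, ρ.sum_mul_repr_t]
  rfl

theorem sat_CtZero (u : Fin n → ℤ) :
    ρ.CtZero.Sat u ↔ 𝒜.t (fun i => (u i : ℚ)) ∈ 𝒜.Z := by
  rw [CtZero, Formula.sat_conj, List.forall_mem_ofFn_iff, ← ρ.C_eq]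
  refine forall_congr' fun i => ?_
  rw [Formula.sat_eq, ρ.sum_mul_repr_t, Int.cast_eq_zero]
  rfl

/-- The given transition itself supplies the witnesses: `u` for `x` and `u'` for `x'`. -/
theorem sat_G {u u' : Fin n → ℤ} (hF : F.Sat (Fin.append u u')) (hC : ρ.CtZero.Sat u) :
    ρ.G.Sat fun i => (ρ.ptTerm i).eval u := by
  have hu (w : Fin ρ.q → ℤ) :
      (fun j => Fin.append w (Fin.append u u') (Fin.natAdd ρ.q (Fin.castAdd n j))) = u := by
    funext j
    rw [Fin.append_right, Fin.append_left]
  refine Formula.sat_exs_of_sat _ _ _ (Fin.append u u') ⟨?_, ?_, ?_⟩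
  · rw [Formula.sat_rename]
    convert hF
    funext j
    exact Fin.append_right _ _ j
  · rw [Formula.sat_conj, List.forall_mem_ofFn_iff]
    intro i
    rw [Formula.sat_eq, Term.eval_subst]
    simp only [Term.eval]
    rw [hu, Fin.append_left]
  · rw [Formula.sat_rename]
    convert hC
    exact hu _

/-- The lattice of the states of `T` with integral coordinates. -/
def lattice : Submodule ℤ (𝒜.V × ℚ) := Submodule.span ℤ (Set.range ρ.basisT)

theorem t_mem_lattice (u : Fin n → ℤ) : 𝒜.t (fun i => (u i : ℚ)) ∈ ρ.lattice := by
  refine (ρ.basisT.mem_span_iff_repr_mem ℤ _).mpr fun j => ?_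
  exact ⟨_, (ρ.repr_t u j).symm⟩

/-- The projection fixes `ℤ(T)`, so the terms compute the coordinates of `t (u k)` itself. There `T`
acts as a linear map with matrix `M`, and the computation is its orbit. -/
theorem isPowImage_eval_ptTerm (u : ℕ → Fin n → ℤ)
    (hZ : ∀ k, 𝒜.t (fun i => (u k i : ℚ)) ∈ 𝒜.Z)
    (hT : ∀ k, (𝒜.t fun i => (u k i : ℚ), 𝒜.t fun i => (u (k + 1) i : ℚ)) ∈ 𝒜.T) (k : ℕ) :
    IsPowImage ρ.M (fun i => (ρ.ptTerm i).eval (u 0)) k fun i => (ρ.ptTerm i).eval (u k) := by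
  have hrepr (k : ℕ) : (fun i => ((ρ.ptTerm i).eval (u k) : ℚ)) =
      ρ.basisZ.repr ⟨_, hZ k⟩ := by
    funext i
    rw [eval_ptTerm]
    exact congrArg (fun z => ρ.basisZ.repr z i) (ρ.proj_apply ⟨_, hZ k⟩)
  have hpow := inducedMap_pow_eq 𝒜.T 𝒜.deterministic _ (exists_succ_intSpace _ 𝒜.deterministic)
    (fun k => ⟨_, hZ k⟩) hT k
  change (𝒜.TZ ^ k) ⟨_, hZ 0⟩ = ⟨_, hZ k⟩ at hpow
  rw [IsPowImage, hrepr, hrepr, M, LinearMap.toMatrix_pow, LinearMap.toMatrix_mulVec_repr, hpow]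

end Representation

end MortalPrecondition

/-! ### Soundness -/

theorem mainTheorem6 {n : ℕ} (F : MortalPrecondition.Formula (n + n))
    (run : MortalPrecondition.Run F) (s : Fin n → ℚ) (hs : s ∈ run.mp) :
    s ∉ MortalPrecondition.domOmega (MortalPrecondition.tfRel F) := by
  open MortalPrecondition in
  rintro ⟨f, rfl, hf⟩
  choose u u' hu hu' hF using hf
  -- Each step chooses its own integer vectors for its two ends; adjacent steps share a rational
  -- state, and the cast `ℤ → ℚ` is injective.
  have hsucc (k : ℕ) : u' k = u (k + 1) := by
    funext i
    have := congrFun ((hu' k).symm.trans (hu (k + 1))) i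
    exact_mod_cast this
  let 𝒜 := run.abstraction
  let ρ := run.representation
  have hT (k : ℕ) : (𝒜.t fun i => (u k i : ℚ), 𝒜.t fun i => (u (k + 1) i : ℚ)) ∈ 𝒜.T :=
    𝒜.t_mem_T ⟨u k, u (k + 1), rfl, rfl, hsucc k ▸ hF k⟩
  have hZ (k : ℕ) : 𝒜.t (fun i => (u k i : ℚ)) ∈ 𝒜.Z :=
    mem_intSpace_of_mem_lattice 𝒜.T 𝒜.deterministic 𝒜.isReflection.1.2.2 ρ.lattice
      (Submodule.fg_span (Set.finite_range _)) _ hT (fun k => ρ.t_mem_lattice (u k)) k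
  have hC (k : ℕ) : ρ.CtZero.Sat (u k) := (ρ.sat_CtZero (u k)).mpr (hZ k)
  -- Membership in `run.mp`, read at the integer valuation `u 0`, refutes the conjunction under the
  -- negation; it remains to prove the conjunct on the `H i`.
  refine hs (u 0) (hu 0) ⟨?_, hC 0⟩
  rw [Formula.sat_conj, List.forall_mem_ofFn_iff]
  intro i
  rw [QF.sat_subst]
  exact run.charSeq.sat_of_forall_sat (ρ.isPowImage_eval_ptTerm u hZ hT)
    (fun k => ρ.sat_G (hF k) (hC k)) i
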